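/- Let $(\mathcal X,d)$ be a metric space and $\mu$ a regular Borel measure on $\mathcal X$ such that all balls $B(x,r)=\{y: d(x,y)<r\}$, $r\in(0,\infty)$, have positive and finite measure, and assume that $\mu$ is doubling: there exist constants $C_1>1$ and $n>0$ such that $\mu(B(x,\lambda r))\le C_1\lambda^n\mu(B(x,r))$ for all $x\in\mathcal X$, $r\in(0,\infty)$ and $\lambda\in(1,\infty)$. Let $s\in(0,\infty)$ and $p,q\in(0,\infty]$. The homogeneous Besov space $\dot B^s_{p,q}(\mathcal X)$ is the collection of all real-valued functions $u$ on $\mathcal X$ that belong to $L^p(B)$ for every ball $B$ and satisfy $$\|u\|_{\dot B^s_{p,q}(\mathcal X)}=\left(\int_0^\infty\left(\int_{\mathcal X}\frac1{\mu(B(x,t))}\int_{B(x,t)}|u(x)-u(y)|^p\,d\mu(y)\,d\mu(x)\right)^{q/p}\frac{dt}{t^{1+sq}}\right)^{1/q}<\infty,$$ where for $p=\infty$ the expression $\big(\int_{\mathcal X}\frac1{\mu(B(x,t))}\int_{B(x,t)}|u(x)-u(y)|^p\,d\mu(y)\,d\mu(x)\big)^{1/p}$ is replaced by $\operatorname{ess\,sup}_{x\in\mathcal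 X}\operatorname{ess\,sup}_{y\in B(x,t)}|u(x)-u(y)|$, and for $q=\infty$ the outer integral $\big(\int_0^\infty (\cdot)^q\,\frac{dt}{t^{1+sq}}\big)^{1/q}$ is replaced by $\sup_{t>0}t^{-s}(\cdot)$. For a measurable function $u:\mathcal X\to\mathbb R$, a sequence $\vec g=\{g_k\}_{k\in\mathbb Z}$ of nonnegative measurable functions on $\mathcal X$ is called a fractional $s$-Hajłasz gradient of $u$ if there exists $E\subset\mathcal X$ with $\mu(E)=0$ such that for all $k\in\mathbb Z$ and all $x,y\in\mathcal X\setminus E$ with $2^{-k-1}\le d(x,y)<2^{-k}$, $$|u(x)-u(y)|\le d(x,y)^s\,[g_k(x)+g_k(y)].$$ The homogeneous Hajłasz–Besov space $\dot N^s_{p,q}(\mathcal X)$ is the space of all measurable functions $u:\mathcal X\to\mathbb R$ such that $$\|u\|_{\dot N^s_{p,q}(\mathcal X)}=\inf_{\vec g}\left(\sum_{k\in\mathbb Z}\|g_k\|_{L^p(\mathcal X)}^q\right)^{1/q}<\infty,$$ where the infimum is over all fractional $s$-Hajłasz gradients $\vec g$ of $u$ and $\big(\sum_k(\cdot)^q\big)^{1/q}$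 is replaced by $\sup_k$ when $q=\infty$. Theorem. For all $s\in(0,\infty)$ and $p,q\in(0,\infty]$, $\dot N^s_{p,q}(\mathcal X)=\dot B^s_{p,q}(\mathcal X)$ as sets of functions, with equivalent (quasi-)seminorms: there is a constant $C$, independent of $u$, such that for every $u$ in this space $$\|u\|_{\dot B^s_{p,q}(\mathcal X)}\le C\|u\|_{\dot N^s_{p,q}(\mathcal X)}\quad\text{and}\quad \|u\|_{\dot N^s_{p,q}(\mathcal X)}\le C\|u\|_{\dot B^s_{p,q}(\mathcal X)}.$$ -/

import Mathlib

open MeasureTheory Set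
open scoped ENNReal NNReal

namespace MetricBesov

/-- `μ` is a doubling measure on the metric space `X`: all (open) balls have positive and finite
measure, and `μ(B(x, λr)) ≤ C₁ λⁿ μ(B(x, r))` for some constants `C₁ > 1`, `n > 0`. -/
structure IsDoubling {X : Type*} [MetricSpace X] [MeasurableSpace X] (μ : Measure X) : Prop where
  ball_pos : ∀ (x : X) (r : ℝ), 0 < r → 0 < μ (Metric.ball x r)
  ball_lt_top : ∀ (x : X) (r : ℝ), 0 < r → μ (Metric.ball x r) < ∞
  doubling : ∃ C₁ n : ℝ, 1 < C₁ ∧ 0 < n ∧ ∀ (x : X) (r l : ℝ), 0 < r → 1 < l →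
    μ (Metric.ball x (l * r)) ≤ ENNReal.ofReal (C₁ * l ^ n) * μ (Metric.ball x r)

section

variable {X : Type*} [MetricSpace X] [MeasurableSpace X]

/-- The `L^p`-averaged difference of `u` at scale `t`,
`(∫_X ⨍_{B(x,t)} |u(x) - u(y)|^p dμ(y) dμ(x))^{1/p}`; for `p = ∞` both averages are replaced by
essential suprema. -/
noncomputable def avgDiff (μ : Measure X) (p : ℝ≥0∞) (u : X → ℝ) (t : ℝ) : ℝ≥0∞ :=
  if p = ∞ then
    essSup (fun x => essSup (fun y => ‖u x - u y‖ₑ) (μ.restrict (Metric.ball x t))) μ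
  else
    (∫⁻ x, ⨍⁻ y in Metric.ball x t, ‖u x - u y‖ₑ ^ p.toReal ∂μ ∂μ) ^ (1 / p.toReal)

/-- The homogeneous Besov (quasi-)seminorm
`(∫_0^∞ (∫_X ⨍_{B(x,t)} |u(x) - u(y)|^p dμ(y) dμ(x))^{q/p} dt / t^{1+sq})^{1/q}`;
for `q = ∞` it is `sup_{t > 0} t^{-s} (avgDiff at scale t)`. -/
noncomputable def besovNorm (μ : Measure X) (s : ℝ) (p q : ℝ≥0∞) (u : X → ℝ) : ℝ≥0∞ :=
  if q = ∞ then
    ⨆ t ∈ Ioi (0 : ℝ), ENNReal.ofReal (t ^ (-s)) * avgDiff μ p u t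
  else
    (∫⁻ t in Ioi (0 : ℝ),
      avgDiff μ p u t ^ q.toReal / ENNReal.ofReal (t ^ (1 + s * q.toReal))) ^ (1 / q.toReal)

/-- The homogeneous Besov space: all `u` that are in `L^p(B)` for each ball `B` and have finite
Besov seminorm. -/
def besovSpace (μ : Measure X) (s : ℝ) (p q : ℝ≥0∞) : Set (X → ℝ) :=
  {u | (∀ (x : X) (r : ℝ), 0 < r → MemLp u p (μ.restrict (Metric.ball x r))) ∧
    besovNorm μ s p q u < ∞}

/-- `g = (g_k)_{k ∈ ℤ}` is a fractional `s`-Hajłasz gradient of `u`. -/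
def IsHajlaszGradient (μ : Measure X) (s : ℝ) (u : X → ℝ) (g : ℤ → X → ℝ) : Prop :=
  (∀ k, AEStronglyMeasurable (g k) μ) ∧ (∀ k x, 0 ≤ g k x) ∧
    ∃ E : Set X, μ E = 0 ∧ ∀ (k : ℤ) (x y : X), x ∉ E → y ∉ E →
      (2 : ℝ) ^ (-k - 1) ≤ dist x y → dist x y < (2 : ℝ) ^ (-k) →
        |u x - u y| ≤ dist x y ^ s * (g k x + g k y)

/-- The `ℓ^q(L^p(X))` (quasi-)norm of a sequence of functions indexed by `ℤ`. -/
noncomputable def lqLpNorm (μ : Measure X) (p q : ℝ≥0∞) (g : ℤ → X → ℝ) : ℝ≥0∞ :=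
  if q = ∞ then ⨆ k, eLpNorm (g k) p μ
  else (∑' k, eLpNorm (g k) p μ ^ q.toReal) ^ (1 / q.toReal)

/-- The homogeneous Hajłasz-Besov (quasi-)seminorm: the infimum of the `ℓ^q(L^p(X))` norms of all
fractional `s`-Hajłasz gradients of `u`. -/
noncomputable def hajlaszBesovNorm (μ : Measure X) (s : ℝ) (p q : ℝ≥0∞) (u : X → ℝ) : ℝ≥0∞ :=
  ⨅ (g : ℤ → X → ℝ) (_ : IsHajlaszGradient μ s u g), lqLpNorm μ p q g

/-- The homogeneous Hajłasz-Besov space: all measurable `u` with finite Hajłasz-Besov seminorm. -/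
def hajlaszBesovSpace (μ : Measure X) (s : ℝ) (p q : ℝ≥0∞) : Set (X → ℝ) :=
  {u | AEStronglyMeasurable u μ ∧ hajlaszBesovNorm μ s p q u < ∞}

end

end MetricBesov

/-!
By doubling, `t ↦ t ^ (-s) * avgDiff μ p u t` changes at most by a constant factor when `t` is at
most doubled, so the Besov seminorm is comparable to the `ℓ^q` norm of its values at the dyadic
scales `t = 2 ^ m`.

If `g` is a fractional `s`-Hajłasz gradient of `u`, then the weighted supremum
`G_j = sup_{i ≥ 0} 2^{-is} g_{j+i}` satisfies `|u(x) - u(y)| ≤ 2^{-js} (G_j(x) + G_j(y))` for almost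
all `x` and `y` at distance below `2^{-j}`. Averaging over balls is bounded on `L^p`, so
`2^{js} avgDiff μ p u (2^{-j})` is at most a multiple of `‖G_j‖_{L^p}`. Since `2^{-s} < 1`, a
discrete Hardy inequality bounds the `ℓ^q(L^p)` norm of `(G_j)` by that of `(g_k)`.

Conversely, if `t / 4 ≤ d(x, y) < t / 2`, then comparing `u(x)` and `u(y)` with the values of `u` on
a ball contained in both `B(x, t)` and `B(y, t)` bounds `|u(x) - u(y)|` by a multiple of the sum of
`(⨍_{B(x,t)} |u(x) - u(z)|^p dμ(z))^{1/p}` and the same quantity for `y`. With `t = 2^{1-k}`, these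
oscillations, multiplied by a constant times `t^{-s}`, form a fractional `s`-Hajłasz gradient of
`u`, whose `ℓ^q(L^p)` norm is a multiple of the discretized Besov seminorm.
-/

namespace MetricBesov

open Metric ProbabilityTheory

theorem ennreal_inv_le_mul_inv {a b c : ℝ≥0∞} (hb₀ : b ≠ 0) (hb : b ≠ ∞) (h : b ≤ c * a) :
    a⁻¹ ≤ c * b⁻¹ := by
  rw [← div_eq_mul_inv, ENNReal.le_div_iff_mul_le (.inl hb₀) (.inl hb), mul_comm,
    ← div_eq_mul_inv]
  exact ENNReal.div_le_of_le_mul h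

section Lebesgue

variable {α : Type*} [MeasurableSpace α] {μ ν : Measure α} {p q : ℝ≥0∞}

theorem cond_le_smul_cond {s t : Set α} {c : ℝ≥0∞} (hst : s ⊆ t) (ht₀ : μ t ≠ 0) (ht : μ t ≠ ∞)
    (h : μ t ≤ c * μ s) : μ[|s] ≤ c • μ[|t] := by
  have hinv : (μ s)⁻¹ ≤ c * (μ t)⁻¹ := ennreal_inv_le_mul_inv ht₀ ht h
  calc (μ s)⁻¹ • μ.restrict s ≤ (c * (μ t)⁻¹) • μ.restrict t := by gcongr
    _ = c • μ[|t] := (smul_smul _ _ _).symm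

theorem eLpNorm_le_of_measure_le_smul {ε : Type*} [TopologicalSpace ε] [ContinuousENorm ε]
    {c : ℝ≥0∞} (h : ν ≤ c • μ) (f : α → ε) :
    eLpNorm f p ν ≤ c ^ (1 / p).toReal * eLpNorm f p μ := by
  rcases eq_or_ne c 0 with rfl | hc
  · rw [zero_smul, Measure.nonpos_iff_eq_zero'] at h
    simp [h]
  · exact (eLpNorm_mono_measure f h).trans_eq (eLpNorm_smul_measure_of_ne_zero hc f p μ)

theorem ae_lt_top_of_eLpNorm_ne_top {f : α → ℝ≥0∞} (hf : AEMeasurable f μ) (hp : p ≠ 0)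
    (h : eLpNorm f p μ ≠ ∞) : ∀ᵐ x ∂μ, f x < ∞ := by
  rcases eq_or_ne p ∞ with rfl | hp'
  · filter_upwards [enorm_ae_le_eLpNormEssSup f μ] with x hx
    exact (hx.trans_lt h.lt_top)
  · have hlintegral := lintegral_rpow_enorm_lt_top_of_eLpNorm_lt_top hp hp' h.lt_top
    filter_upwards [ae_lt_top' (hf.enorm.pow_const _) hlintegral.ne] with x hx
    exact (ENNReal.rpow_lt_top_iff_of_pos (ENNReal.toReal_pos hp hp')).1 hx

theorem measurable_eLpNorm_kernel {β : Type*} [MeasurableSpace β] (κ : Kernel α β)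
    [IsSFiniteKernel κ] {f : α → β → ℝ≥0∞} (hf : Measurable (Function.uncurry f)) :
    Measurable fun x => eLpNorm (f x) p (κ x) := by
  rcases eq_or_ne p 0 with rfl | hp
  · simp
  rcases eq_or_ne p ∞ with rfl | hp'
  · refine measurable_of_Iic fun c => ?_
    have hset : MeasurableSet {z : α × β | c < Function.uncurry f z} :=
      measurableSet_lt measurable_const hf
    convert Kernel.measurable_kernel_prodMk_left (κ := κ) hset (measurableSet_singleton 0) using 1
    ext x
    have hiff : eLpNorm (f x) ∞ (κ x) ≤ c ↔ ∀ᵐ y ∂κ x, f x y ≤ c :=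
      ⟨fun h => (enorm_ae_le_eLpNormEssSup (f x) (κ x)).mono fun y hy => hy.trans h,
        essSup_le_of_ae_le c⟩
    exact hiff.trans (by simp only [ae_iff, not_le]; rfl)
  · simp only [eLpNorm_eq_lintegral_rpow_enorm_toReal hp hp', enorm_eq_self]
    exact (Measurable.lintegral_kernel_prod_right' (hf.pow_const _)).pow_const _

theorem eLpNorm_eLpNorm_eq_lintegral {β ε : Type*} [MeasurableSpace β] [ENorm ε] (hp : p ≠ 0)
    (hp' : p ≠ ∞) (κ : α → Measure β) (f : α → β → ε) :
    eLpNorm (fun x => eLpNorm (f x) p (κ x)) p μ =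
      (∫⁻ x, ∫⁻ y, ‖f x y‖ₑ ^ p.toReal ∂κ x ∂μ) ^ (1 / p.toReal) := by
  simp only [eLpNorm_eq_lintegral_rpow_enorm_toReal hp hp', enorm_eq_self, ← ENNReal.rpow_mul,
    one_div_mul_cancel (ENNReal.toReal_pos hp hp').ne', ENNReal.rpow_one]

theorem iSup_rpow_le_tsum_rpow {ι : Type*} {r : ℝ} (hr : 0 < r) (a : ι → ℝ≥0∞) :
    (⨆ i, a i) ^ r ≤ ∑' i, a i ^ r :=
  ((ENNReal.orderIsoRpow r hr).map_iSup a).trans_le (iSup_le ENNReal.le_tsum)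

theorem tsum_pow_rpow_ne_top {ρ : ℝ≥0∞} (hρ : ρ < 1) {r : ℝ} (hr : 0 < r) :
    ∑' i : ℕ, (ρ ^ i) ^ r ≠ ∞ := by
  simp_rw [← ENNReal.rpow_natCast, ← ENNReal.rpow_mul, mul_comm _ r, ENNReal.rpow_mul,
    ENNReal.rpow_natCast, ENNReal.tsum_geometric]
  exact ENNReal.inv_ne_top.2 (tsub_pos_iff_lt.2 (ENNReal.rpow_lt_one hρ hr)).ne'

theorem eLpNorm_iSup_rpow_le_tsum (hp : p ≠ 0) (hp' : p ≠ ∞) {ι : Type*} [Countable ι]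
    {f : ι → α → ℝ≥0∞} (hf : ∀ i, AEMeasurable (f i) μ) :
    eLpNorm (fun x => ⨆ i, f i x) p μ ^ p.toReal ≤ ∑' i, eLpNorm (f i) p μ ^ p.toReal := by
  have hr : 0 < p.toReal := ENNReal.toReal_pos hp hp'
  have hpow : ∀ h : α → ℝ≥0∞, eLpNorm h p μ ^ p.toReal = ∫⁻ x, h x ^ p.toReal ∂μ := fun h => by
    rw [eLpNorm_eq_lintegral_rpow_enorm_toReal hp hp', ← ENNReal.rpow_mul,
      one_div_mul_cancel hr.ne', ENNReal.rpow_one]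
    rfl
  simp only [hpow]
  rw [← lintegral_tsum fun i => (hf i).pow_const _]
  exact lintegral_mono fun x => iSup_rpow_le_tsum_rpow hr _

theorem exists_eLpNorm_iSup_pow_mul_le (μ : Measure α) (hp : p ≠ 0) {ρ : ℝ≥0∞} (hρ : ρ < 1) :
    ∃ C ≠ (∞ : ℝ≥0∞), ∀ f : ℕ → α → ℝ≥0∞, (∀ i, AEMeasurable (f i) μ) →
      eLpNorm (fun x => ⨆ i, ρ ^ i * f i x) p μ ≤ C * ⨆ i, eLpNorm (f i) p μ := by
  rcases eq_or_ne p ∞ with rfl | hp'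
  · refine ⟨1, ENNReal.one_ne_top, fun f _ => ?_⟩
    have hbound : ∀ᵐ x ∂μ, ∀ i, f i x ≤ eLpNorm (f i) ∞ μ :=
      ae_all_iff.2 fun i => enorm_ae_le_eLpNormEssSup (f i) μ
    rw [one_mul]
    refine essSup_le_of_ae_le _ (hbound.mono fun x hx => iSup_mono fun i => ?_)
    exact (mul_le_of_le_one_left' (pow_le_one' hρ.le i)).trans (hx i)
  · have hr : 0 < p.toReal := ENNReal.toReal_pos hp hp'
    refine ⟨(∑' i : ℕ, (ρ ^ i) ^ p.toReal) ^ (1 / p.toReal), ENNReal.rpow_ne_top_of_nonneg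
      (by positivity) (tsum_pow_rpow_ne_top hρ hr), fun f hf => ?_⟩
    rw [← ENNReal.rpow_le_rpow_iff hr, ENNReal.mul_rpow_of_nonneg _ _ hr.le, ← ENNReal.rpow_mul,
      one_div_mul_cancel hr.ne', ENNReal.rpow_one, ← ENNReal.tsum_mul_right]
    refine (eLpNorm_iSup_rpow_le_tsum hp hp' fun i => (hf i).const_mul _).trans
      (ENNReal.tsum_le_tsum fun i => ?_)
    rw [← ENNReal.mul_rpow_of_nonneg _ _ hr.le]
    gcongr
    calc eLpNorm (fun x => ρ ^ i * f i x) p μ ≤ ρ ^ i * eLpNorm (f i) p μ :=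
          eLpNorm_le_mul_eLpNorm_of_ae_le_mul'' p (hf i).aestronglyMeasurable
            (ae_of_all _ fun x => le_rfl)
      _ ≤ ρ ^ i * ⨆ i, eLpNorm (f i) p μ := by
          gcongr
          exact le_iSup (fun i => eLpNorm (f i) p μ) i

theorem eLpNorm_count_le_mul {ι : Type*} [MeasurableSpace ι] [DiscreteMeasurableSpace ι]
    {a b : ι → ℝ≥0∞} {c : ℝ≥0∞} (h : ∀ k, a k ≤ c * b k) (q : ℝ≥0∞) :
    eLpNorm a q Measure.count ≤ c * eLpNorm b q Measure.count :=
  eLpNorm_le_mul_eLpNorm_of_ae_le_mul'' q Measurable.of_discrete.aestronglyMeasurable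
    (ae_of_all _ h)

theorem eLpNorm_count_comp {ι : Type*} [MeasurableSpace ι] [DiscreteMeasurableSpace ι]
    (a : ι → ℝ≥0∞) {e : ι → ι} (he : MeasurePreserving e Measure.count Measure.count) :
    eLpNorm (fun k => a (e k)) q Measure.count = eLpNorm a q Measure.count :=
  eLpNorm_comp_measurePreserving Measurable.of_discrete.aestronglyMeasurable he

theorem exists_eLpNorm_count_eLpNorm_iSup_le {E : Type*} [TopologicalSpace E] [ContinuousENorm E]
    (μ : Measure α) (hp : p ≠ 0) (hq : q ≠ 0) {ρ : ℝ≥0∞} (hρ : ρ < 1) :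
    ∃ C ≠ (∞ : ℝ≥0∞), ∀ g : ℤ → α → E, (∀ k, AEStronglyMeasurable (g k) μ) →
      eLpNorm (fun k => eLpNorm (fun x => ⨆ i : ℕ, ρ ^ i * ‖g (k + i) x‖ₑ) p μ) q Measure.count ≤
        C * eLpNorm (fun k => eLpNorm (g k) p μ) q Measure.count := by
  set σ := ρ ^ (2⁻¹ : ℝ)
  have hσ : σ < 1 := ENNReal.rpow_lt_one hρ (by norm_num)
  have hσρ : ∀ i : ℕ, ρ ^ i = σ ^ i * σ ^ i := fun i => by
    rw [← mul_pow, ← ENNReal.rpow_add_of_nonneg _ _ (by norm_num) (by norm_num)]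
    norm_num
  obtain ⟨C₁, hC₁, h₁⟩ := exists_eLpNorm_iSup_pow_mul_le μ hp hσ
  obtain ⟨C₂, hC₂, h₂⟩ := exists_eLpNorm_iSup_pow_mul_le (Measure.count : Measure ℤ) hq hσ
  refine ⟨C₁ * C₂, by finiteness, fun g hg => ?_⟩
  have hscale : ∀ k, eLpNorm (fun x => ⨆ i : ℕ, ρ ^ i * ‖g (k + i) x‖ₑ) p μ ≤
      C₁ * ⨆ i : ℕ, σ ^ i * eLpNorm (g (k + i)) p μ := fun k => by
    simp only [hσρ, mul_assoc]
    refine (h₁ _ fun i => (hg _).enorm.const_mul _).trans ?_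
    gcongr with i
    exact eLpNorm_le_mul_eLpNorm_of_ae_le_mul'' p (hg _) (ae_of_all _ fun x => le_rfl)
  calc eLpNorm (fun k => eLpNorm (fun x => ⨆ i : ℕ, ρ ^ i * ‖g (k + i) x‖ₑ) p μ) q Measure.count
      ≤ C₁ * eLpNorm (fun k => ⨆ i : ℕ, σ ^ i * eLpNorm (g (k + i)) p μ) q Measure.count :=
        eLpNorm_count_le_mul hscale q
    _ ≤ C₁ * (C₂ * ⨆ i : ℕ, eLpNorm (fun k => eLpNorm (g (k + i)) p μ) q Measure.count) := by
        gcongr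
        exact h₂ (fun i k => eLpNorm (g (k + i)) p μ) fun i => Measurable.of_discrete.aemeasurable
    _ = C₁ * C₂ * eLpNorm (fun k => eLpNorm (g k) p μ) q Measure.count := by
        simp only [eLpNorm_count_comp (fun k => eLpNorm (g k) p μ)
          (measurePreserving_add_right _ _), ciSup_const, mul_assoc]

end Lebesgue

section BallMeasurability

variable {X : Type*} [PseudoMetricSpace X] [MeasurableSpace X] [BorelSpace X]
  [SecondCountableTopology X] {μ : Measure X} {p : ℝ≥0∞}

theorem measurableSet_dist_lt (t : ℝ) : MeasurableSet {z : X × X | dist z.2 z.1 < t} :=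
  measurableSet_lt (measurable_snd.dist measurable_fst) measurable_const

theorem measurable_measure_ball [SFinite μ] (t : ℝ) : Measurable fun x => μ (ball x t) :=
  measurable_measure_prodMk_left (measurableSet_dist_lt t)

theorem measurable_cond_ball [SFinite μ] (t : ℝ) : Measurable fun x => μ[|ball x t] := by
  refine Measure.measurable_of_measurable_coe _ fun s hs => ?_
  simp only [cond_apply measurableSet_ball]
  exact (measurable_measure_ball t).inv.mul
    (measurable_measure_prodMk_left ((measurableSet_dist_lt t).inter (measurable_snd hs)))

theorem lintegral_setLIntegral_ball [SFinite μ] {f : X → ℝ≥0∞} (hf : AEMeasurable f μ) (t : ℝ) :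
    ∫⁻ x, ∫⁻ y in ball x t, f y ∂μ ∂μ = ∫⁻ y, f y * μ (ball y t) ∂μ := by
  have hswap := lintegral_lintegral_swap (μ := μ) (ν := μ)
    (f := fun x y => (ball x t).indicator f y)
    (hf.comp_snd.indicator (measurableSet_dist_lt t))
  simp only [lintegral_indicator measurableSet_ball] at hswap
  rw [hswap]
  refine lintegral_congr fun y => ?_
  rw [← setLIntegral_const, ← lintegral_indicator measurableSet_ball]
  refine lintegral_congr fun x => ?_
  simp only [indicator, mem_ball, dist_comm y x]

theorem aemeasurable_eLpNorm_cond_ball [SFinite μ] {f : X → X → ℝ≥0∞}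
    (hf : AEMeasurable (Function.uncurry f) (μ.prod μ)) (t : ℝ) :
    AEMeasurable (fun x => eLpNorm (f x) p μ[|ball x t]) μ := by
  let κ : Kernel X X := ⟨fun x => μ[|ball x t], measurable_cond_ball t⟩
  have : IsFiniteKernel κ := ⟨1, ENNReal.one_lt_top,
    fun x => (prob_le_one : μ[|ball x t] univ ≤ 1)⟩
  refine ⟨fun x => eLpNorm (fun y => hf.mk _ (x, y)) p (κ x),
    measurable_eLpNorm_kernel κ (f := fun x y => hf.mk _ (x, y)) hf.measurable_mk, ?_⟩
  filter_upwards [Measure.ae_ae_of_ae_prod hf.ae_eq_mk] with x hx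
  exact eLpNorm_congr_ae (cond_absolutelyContinuous.ae_le hx)

end BallMeasurability

section Doubling

variable {X : Type*} [MetricSpace X] [MeasurableSpace X] {μ : Measure X} {p : ℝ≥0∞}

/-- The doubling constant of `μ`, used to compare the measures of nearby balls with comparable
radii. The radius is enlarged by the factor `4`, which covers all comparisons made below. -/
noncomputable def doublingConst (μ : Measure X) : ℝ≥0∞ :=
  ⨆ (x : X) (r : ℝ) (_ : 0 < r), μ (ball x (4 * r)) / μ (ball x r)

namespace IsDoubling

theorem doublingConst_ne_top (hμ : IsDoubling μ) : doublingConst μ ≠ ∞ := by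
  obtain ⟨C, n, -, -, h⟩ := hμ.doubling
  refine ne_top_of_le_ne_top (ENNReal.ofReal_ne_top (r := C * 4 ^ n))
    (iSup_le fun x => iSup₂_le fun r hr => ENNReal.div_le_of_le_mul ?_)
  exact h x r 4 hr (by norm_num)

theorem measure_ball_le (hμ : IsDoubling μ) {x : X} {r : ℝ} (hr : 0 < r) {A : Set X}
    (hA : A ⊆ ball x (4 * r)) : μ A ≤ doublingConst μ * μ (ball x r) := by
  refine (measure_mono hA).trans ?_
  rw [← ENNReal.div_le_iff (hμ.ball_pos x r hr).ne' (hμ.ball_lt_top x r hr).ne]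
  exact le_iSup_of_le x (le_iSup₂_of_le r hr le_rfl)

theorem isProbabilityMeasure_cond_ball (hμ : IsDoubling μ) (x : X) {r : ℝ} (hr : 0 < r) :
    IsProbabilityMeasure μ[|ball x r] :=
  cond_isProbabilityMeasure_of_finite (hμ.ball_pos x r hr).ne' (hμ.ball_lt_top x r hr).ne

theorem eLpNorm_cond_ball_le {ε : Type*} [TopologicalSpace ε] [ContinuousENorm ε]
    (hμ : IsDoubling μ) {x y : X} {r R : ℝ} (hr : 0 < r) (hR : 0 < R)
    (hsub : ball x r ⊆ ball y R) (hsup : ball y R ⊆ ball x (4 * r)) (f : X → ε) :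
    eLpNorm f p μ[|ball x r] ≤ doublingConst μ ^ (1 / p).toReal * eLpNorm f p μ[|ball y R] :=
  eLpNorm_le_of_measure_le_smul (cond_le_smul_cond hsub (hμ.ball_pos y R hR).ne'
    (hμ.ball_lt_top y R hR).ne (hμ.measure_ball_le hr hsup)) f

theorem sigmaFinite (hμ : IsDoubling μ) : SigmaFinite μ := by
  rcases isEmpty_or_nonempty X with hX | ⟨⟨x₀⟩⟩
  · rw [Measure.eq_zero_of_isEmpty μ]
    infer_instance
  · exact ⟨⟨⟨fun n => ball x₀ (n + 1), fun _ => trivial,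
      fun n => hμ.ball_lt_top _ _ (by positivity), iUnion_ball_nat_succ x₀⟩⟩⟩

theorem secondCountableTopology [BorelSpace X] (hμ : IsDoubling μ) :
    SecondCountableTopology X := by
  have := hμ.sigmaFinite
  refine secondCountable_of_almost_dense_set fun ε hε => ?_
  obtain ⟨S, -, hdisj, hcover⟩ := Vitali.exists_disjoint_subfamily_covering_enlargement_closedBall
    (univ : Set X) id (fun _ => ε / 4) (ε / 4) (fun _ _ => le_rfl) 4 (by norm_num)
  have hpos : ∀ x : S, 0 < μ (closedBall (x : X) (ε / 4)) := fun x =>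
    (hμ.ball_pos x (ε / 4) (by positivity)).trans_le (measure_mono ball_subset_closedBall)
  have hcount := Measure.countable_meas_pos_of_disjoint_iUnion (μ := μ)
    (fun x : S => isClosed_closedBall.measurableSet) (hdisj.subtype _ _)
  refine ⟨S, countable_coe_iff.1 (countable_univ_iff.1 (hcount.mono fun x _ => hpos x)),
    fun x => ?_⟩
  obtain ⟨y, hy, hsub⟩ := hcover x (mem_univ x)
  refine ⟨y, hy, ?_⟩
  simpa [mul_div_cancel₀] using hsub (mem_closedBall_self (by positivity))

end IsDoubling

theorem IsDoubling.lintegral_lintegral_cond_ball_le [BorelSpace X] (hμ : IsDoubling μ)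
    {f : X → ℝ≥0∞} (hf : AEMeasurable f μ) {t : ℝ} (ht : 0 < t) :
    ∫⁻ x, ∫⁻ y, f y ∂μ[|ball x t] ∂μ ≤ doublingConst μ * ∫⁻ x, f x ∂μ := by
  have := hμ.sigmaFinite
  have := hμ.secondCountableTopology
  have hinv : ∀ x, ∀ y ∈ ball x t,
      (μ (ball x t))⁻¹ ≤ doublingConst μ * (μ (ball y t))⁻¹ := fun x y hy => by
    refine ennreal_inv_le_mul_inv (hμ.ball_pos y t ht).ne' (hμ.ball_lt_top y t ht).ne
      (hμ.measure_ball_le ht (ball_subset_ball' ?_))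
    linarith [mem_ball.1 hy]
  calc ∫⁻ x, ∫⁻ y, f y ∂μ[|ball x t] ∂μ
      ≤ ∫⁻ x, ∫⁻ y in ball x t, doublingConst μ * (μ (ball y t))⁻¹ * f y ∂μ ∂μ := by
        refine lintegral_mono fun x => ?_
        rw [ProbabilityTheory.cond, lintegral_smul_measure, smul_eq_mul,
          ← lintegral_const_mul' _ _ (ENNReal.inv_ne_top.2 (hμ.ball_pos x t ht).ne')]
        exact setLIntegral_mono' measurableSet_ball fun y hy => by gcongr; exact hinv x y hy
    _ = ∫⁻ y, doublingConst μ * (μ (ball y t))⁻¹ * f y * μ (ball y t) ∂μ :=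
        lintegral_setLIntegral_ball
          (((measurable_measure_ball t).inv.const_mul _).aemeasurable.mul hf) t
    _ = ∫⁻ y, doublingConst μ * f y ∂μ := by
        refine lintegral_congr fun y => ?_
        rw [mul_right_comm, mul_assoc (doublingConst μ),
          ENNReal.inv_mul_cancel (hμ.ball_pos y t ht).ne' (hμ.ball_lt_top y t ht).ne, mul_one]
    _ = doublingConst μ * ∫⁻ x, f x ∂μ := lintegral_const_mul' _ _ hμ.doublingConst_ne_top

theorem IsDoubling.eLpNorm_eLpNorm_cond_ball_le [BorelSpace X] (hμ : IsDoubling μ) (hp : p ≠ 0)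
    {f : X → ℝ≥0∞} (hf : AEMeasurable f μ) {t : ℝ} (ht : 0 < t) :
    eLpNorm (fun x => eLpNorm f p μ[|ball x t]) p μ ≤
      doublingConst μ ^ (1 / p).toReal * eLpNorm f p μ := by
  rcases eq_or_ne p ∞ with rfl | hp'
  · simp only [ENNReal.div_top, ENNReal.toReal_zero, ENNReal.rpow_zero, one_mul]
    exact essSup_le_of_ae_le _ (ae_of_all _ fun x => essSup_mono_measure cond_absolutelyContinuous)
  · rw [eLpNorm_eLpNorm_eq_lintegral hp hp' (fun x => μ[|ball x t]) fun _ => f,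
      eLpNorm_eq_lintegral_rpow_enorm_toReal hp hp', ENNReal.toReal_div, ENNReal.toReal_one,
      ← ENNReal.mul_rpow_of_nonneg _ _ (by positivity)]
    gcongr
    exact hμ.lintegral_lintegral_cond_ball_le (hf.enorm.pow_const _) ht

end Doubling

section Oscillation

variable {X : Type*} [MetricSpace X] [MeasurableSpace X] {μ : Measure X} {p : ℝ≥0∞} {u : X → ℝ}
  {t : ℝ}

/-- The oscillation `(⨍_{B(x,t)} |u(x) - u(y)|^p dμ(y))^{1/p}` of `u` at `x` on the scale `t`,
whose `L^p` norm in `x` is `avgDiff μ p u t`. The average is encoded as an `L^p` norm with respect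
to the normalized restriction of `μ` to the ball, which gives the essential supremum for
`p = ∞`. -/
noncomputable def localOsc (μ : Measure X) (p : ℝ≥0∞) (u : X → ℝ) (t : ℝ) (x : X) : ℝ≥0∞ :=
  eLpNorm (fun y => u x - u y) p μ[|ball x t]

namespace IsDoubling

theorem aemeasurable_localOsc [BorelSpace X] (hμ : IsDoubling μ) (hu : AEStronglyMeasurable u μ)
    (p : ℝ≥0∞) (t : ℝ) : AEMeasurable (localOsc μ p u t) μ := by
  have := hμ.sigmaFinite
  have := hμ.secondCountableTopology
  refine (aemeasurable_eLpNorm_cond_ball (p := p)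
    (f := fun x y => ‖u x - u y‖ₑ) (hu.comp_fst.sub hu.comp_snd).enorm t).congr ?_
  exact ae_of_all _ fun x => eLpNorm_enorm _

theorem avgDiff_eq_eLpNorm_localOsc (hμ : IsDoubling μ) (hp : p ≠ 0) (u : X → ℝ) (ht : 0 < t) :
    avgDiff μ p u t = eLpNorm (localOsc μ p u t) p μ := by
  rw [avgDiff]
  split_ifs with hp'
  · subst hp'
    have hball : ∀ x, essSup (fun y => ‖u x - u y‖ₑ) (μ.restrict (ball x t)) =
        localOsc μ ∞ u t x := fun x =>
      (essSup_ennreal_smul_measure (ENNReal.inv_ne_zero.2 (hμ.ball_lt_top x t ht).ne) _).symm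
    simp only [hball]
    rfl
  · unfold localOsc
    rw [eLpNorm_eLpNorm_eq_lintegral hp hp' (fun x => μ[|ball x t])]
    simp only [laverage, ProbabilityTheory.cond, Measure.restrict_apply_univ]

theorem localOsc_le_localOsc (hμ : IsDoubling μ) (ht : 0 < t) {t' : ℝ} (h : t ≤ t')
    (h' : t' ≤ 2 * t) (x : X) :
    localOsc μ p u t x ≤ doublingConst μ ^ (1 / p).toReal * localOsc μ p u t' x :=
  hμ.eLpNorm_cond_ball_le ht (ht.trans_le h) (ball_subset_ball h)
    (ball_subset_ball (by linarith)) _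

theorem avgDiff_le_avgDiff [BorelSpace X] (hμ : IsDoubling μ) (hp : p ≠ 0)
    (hu : AEStronglyMeasurable u μ) (ht : 0 < t) {t' : ℝ} (h : t ≤ t') (h' : t' ≤ 2 * t) :
    avgDiff μ p u t ≤ doublingConst μ ^ (1 / p).toReal * avgDiff μ p u t' := by
  rw [hμ.avgDiff_eq_eLpNorm_localOsc hp u ht,
    hμ.avgDiff_eq_eLpNorm_localOsc hp u (ht.trans_le h)]
  exact eLpNorm_le_mul_eLpNorm_of_ae_le_mul'' p
    (hμ.aemeasurable_localOsc hu p t').aestronglyMeasurable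
    (ae_of_all _ (hμ.localOsc_le_localOsc ht h h'))

theorem localOsc_le_of_ae_enorm_sub_le [BorelSpace X] (hμ : IsDoubling μ) (hp : p ≠ 0) (ht : 0 < t)
    {G : X → ℝ≥0∞} (hG : AEMeasurable G μ) {x : X}
    (h : ∀ᵐ y ∂μ, dist y x < t → ‖u x - u y‖ₑ ≤ G x + G y) :
    localOsc μ p u t x ≤ ENNReal.LpAddConst p * (G x + eLpNorm G p μ[|ball x t]) := by
  have := hμ.isProbabilityMeasure_cond_ball x ht
  have hsum : ∀ᵐ y ∂μ[|ball x t], ‖u x - u y‖ₑ ≤ ‖G x + G y‖ₑ := by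
    filter_upwards [cond_absolutelyContinuous.ae_le h, ae_cond_mem measurableSet_ball]
      with y hy hyx using hy hyx
  have hGm : AEStronglyMeasurable G μ[|ball x t] :=
    hG.aestronglyMeasurable.mono_ac cond_absolutelyContinuous
  calc localOsc μ p u t x ≤ eLpNorm ((fun _ => G x) + G) p μ[|ball x t] :=
        eLpNorm_mono_enorm_ae hsum
    _ ≤ ENNReal.LpAddConst p *
          (eLpNorm (fun _ => G x) p μ[|ball x t] + eLpNorm G p μ[|ball x t]) :=
        eLpNorm_add_le' aestronglyMeasurable_const hGm p
    _ = ENNReal.LpAddConst p * (G x + eLpNorm G p μ[|ball x t]) := by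
        rw [eLpNorm_const _ hp (IsProbabilityMeasure.ne_zero _), measure_univ, ENNReal.one_rpow,
          mul_one, enorm_eq_self]

theorem exists_avgDiff_le_mul_eLpNorm [BorelSpace X] (hμ : IsDoubling μ) (hp : p ≠ 0) :
    ∃ C ≠ (∞ : ℝ≥0∞), ∀ (u : X → ℝ) (G : X → ℝ≥0∞) (t : ℝ), 0 < t → AEMeasurable G μ →
      (∀ᵐ x ∂μ, ∀ᵐ y ∂μ, dist y x < t → ‖u x - u y‖ₑ ≤ G x + G y) →
        avgDiff μ p u t ≤ C * eLpNorm G p μ := by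
  have := hμ.sigmaFinite
  have := hμ.secondCountableTopology
  have hD := hμ.doublingConst_ne_top
  set L := ENNReal.LpAddConst p
  have hL : L ≠ ∞ := (ENNReal.LpAddConst_lt_top p).ne
  refine ⟨L * (L * (1 + doublingConst μ ^ (1 / p).toReal)), by finiteness,
    fun u G t ht hG h => ?_⟩
  let A : X → ℝ≥0∞ := fun x => eLpNorm G p μ[|ball x t]
  have hA : AEMeasurable A μ := aemeasurable_eLpNorm_cond_ball (f := fun _ => G) hG.comp_snd t
  calc avgDiff μ p u t = eLpNorm (localOsc μ p u t) p μ :=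
        hμ.avgDiff_eq_eLpNorm_localOsc hp u ht
    _ ≤ L * eLpNorm (G + A) p μ :=
        eLpNorm_le_mul_eLpNorm_of_ae_le_mul'' p (hG.add hA).aestronglyMeasurable
          (h.mono fun x hx => hμ.localOsc_le_of_ae_enorm_sub_le hp ht hG hx)
    _ ≤ L * (L * (eLpNorm G p μ + eLpNorm A p μ)) := by
        gcongr
        exact eLpNorm_add_le' hG.aestronglyMeasurable hA.aestronglyMeasurable p
    _ ≤ L * (L * (eLpNorm G p μ + doublingConst μ ^ (1 / p).toReal * eLpNorm G p μ)) := by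
        gcongr
        exact hμ.eLpNorm_eLpNorm_cond_ball_le hp hG ht
    _ = L * (L * (1 + doublingConst μ ^ (1 / p).toReal)) * eLpNorm G p μ := by ring

theorem exists_enorm_sub_le_localOsc_add (hμ : IsDoubling μ) (hp : p ≠ 0) :
    ∃ C ≠ (∞ : ℝ≥0∞), ∀ u : X → ℝ, AEStronglyMeasurable u μ → ∀ t > 0, ∀ x y, dist x y < t →
      ‖u x - u y‖ₑ ≤ C * (localOsc μ p u (2 * t) x + localOsc μ p u (2 * t) y) := by
  have hD := hμ.doublingConst_ne_top
  set L := ENNReal.LpAddConst p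
  have hL : L ≠ ∞ := (ENNReal.LpAddConst_lt_top p).ne
  refine ⟨L * doublingConst μ ^ (1 / p).toReal, by finiteness, fun u hu t ht x y hxy => ?_⟩
  have := hμ.isProbabilityMeasure_cond_ball x ht
  have hum (w : X) : AEStronglyMeasurable (fun z => u w - u z) μ[|ball x t] :=
    aestronglyMeasurable_const.sub (hu.mono_ac cond_absolutelyContinuous)
  have hball (w : X) (hw : dist x w < t) : eLpNorm (fun z => u w - u z) p μ[|ball x t] ≤
      doublingConst μ ^ (1 / p).toReal * localOsc μ p u (2 * t) w :=
    hμ.eLpNorm_cond_ball_le ht (by positivity) (ball_subset_ball' (by linarith))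
      (ball_subset_ball' (by linarith [dist_comm x w])) _
  calc ‖u x - u y‖ₑ = eLpNorm (fun _ => u x - u y) p μ[|ball x t] := by
        rw [eLpNorm_const _ hp (IsProbabilityMeasure.ne_zero _), measure_univ, ENNReal.one_rpow,
          mul_one]
    _ = eLpNorm ((fun z => u x - u z) - fun z => u y - u z) p μ[|ball x t] := by
        congr 1
        ext z
        simp
    _ ≤ L * (eLpNorm (fun z => u x - u z) p μ[|ball x t] +
          eLpNorm (fun z => u y - u z) p μ[|ball x t]) := eLpNorm_sub_le' (hum x) (hum y) p
    _ ≤ L * (doublingConst μ ^ (1 / p).toReal * localOsc μ p u (2 * t) x +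
          doublingConst μ ^ (1 / p).toReal * localOsc μ p u (2 * t) y) := by
        gcongr
        · exact hball x (by rwa [dist_self])
        · exact hball y hxy
    _ = _ := by ring

end IsDoubling

end Oscillation

section Scale

variable {q c : ℝ≥0∞} {B : ℝ → ℝ≥0∞}

/-- The `L^q` (quasi-)norm on `(0, ∞)` with respect to `dt / t` of a quantity `B` that depends on
the scale `t`. As in `besovNorm`, the case `q = ∞` is a supremum, not an essential supremum. -/
noncomputable def scaleNorm (q : ℝ≥0∞) (B : ℝ → ℝ≥0∞) : ℝ≥0∞ :=
  if q = ∞ then ⨆ t ∈ Ioi (0 : ℝ), B t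
  else (∫⁻ t in Ioi (0 : ℝ), B t ^ q.toReal / ENNReal.ofReal t) ^ (1 / q.toReal)

theorem eLpNorm_count_eq_ite {ι : Type*} [MeasurableSpace ι] [MeasurableSingletonClass ι]
    (hq : q ≠ 0) (a : ι → ℝ≥0∞) :
    eLpNorm a q Measure.count =
      if q = ∞ then ⨆ i, a i else (∑' i, a i ^ q.toReal) ^ (1 / q.toReal) := by
  split_ifs with hq'
  · rw [hq', eLpNorm_exponent_top, eLpNormEssSup_count]
    rfl
  · rw [eLpNorm_eq_lintegral_rpow_enorm_toReal hq hq', lintegral_count]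
    rfl

theorem lqLpNorm_eq_eLpNorm_count {X : Type*} [MeasurableSpace X] (μ : Measure X) (p : ℝ≥0∞)
    (hq : q ≠ 0) (g : ℤ → X → ℝ) :
    lqLpNorm μ p q g = eLpNorm (fun k => eLpNorm (g k) p μ) q Measure.count :=
  (eLpNorm_count_eq_ite hq _).symm

theorem lintegral_Ioi_eq_tsum_Ico_zpow (f : ℝ → ℝ≥0∞) :
    ∫⁻ t in Ioi (0 : ℝ), f t = ∑' m : ℤ, ∫⁻ t in Ico ((2 : ℝ) ^ m) (2 ^ (m + 1)), f t := by
  have hdisj : Pairwise (Function.onFun Disjoint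
      fun m : ℤ => Ico ((2 : ℝ) ^ m) (2 ^ (m + 1))) :=
    (zpow_right_mono₀ one_le_two).pairwise_disjoint_on_Ico_succ
  rw [← lintegral_iUnion (fun _ => measurableSet_Ico) hdisj]
  congr 2
  ext t
  refine ⟨fun ht => mem_iUnion.2 (exists_mem_Ico_zpow ht one_lt_two), fun ht => ?_⟩
  obtain ⟨m, hm⟩ := mem_iUnion.1 ht
  exact (zpow_pos two_pos m).trans_le hm.1

theorem setLIntegral_Ico_div_le {f : ℝ → ℝ≥0∞} {T : ℝ} (hT : 0 < T)
    (h : ∀ t ∈ Ico T (2 * T), f t ≤ c) :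
    ∫⁻ t in Ico T (2 * T), f t / ENNReal.ofReal t ≤ c := by
  have hT' : ENNReal.ofReal T ≠ 0 := (ENNReal.ofReal_pos.2 hT).ne'
  calc ∫⁻ t in Ico T (2 * T), f t / ENNReal.ofReal t
      ≤ ∫⁻ _ in Ico T (2 * T), c / ENNReal.ofReal T := by
        refine setLIntegral_mono' measurableSet_Ico fun t ht => ?_
        gcongr
        exacts [h t ht, ht.1]
    _ = c := by
        rw [setLIntegral_const, Real.volume_Ico, two_mul, add_sub_cancel_right,
          ENNReal.div_mul_cancel hT' ENNReal.ofReal_ne_top]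

theorem le_two_mul_setLIntegral_Ico_div {f : ℝ → ℝ≥0∞} {T : ℝ} (hT : 0 < T)
    (h : ∀ t ∈ Ico T (2 * T), c ≤ f t) :
    c ≤ 2 * ∫⁻ t in Ico T (2 * T), f t / ENNReal.ofReal t := by
  have hT' : ENNReal.ofReal (2 * T) ≠ 0 := (ENNReal.ofReal_pos.2 (by positivity)).ne'
  calc c = 2 * ∫⁻ _ in Ico T (2 * T), c / ENNReal.ofReal (2 * T) := by
        rw [setLIntegral_const, Real.volume_Ico, two_mul T, add_sub_cancel_right, mul_left_comm,
          ← ENNReal.ofReal_ofNat 2, ← ENNReal.ofReal_mul two_pos.le, ← two_mul,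
          ENNReal.div_mul_cancel hT' ENNReal.ofReal_ne_top]
    _ ≤ 2 * ∫⁻ t in Ico T (2 * T), f t / ENNReal.ofReal t := by
        gcongr 2 * ?_
        refine setLIntegral_mono' measurableSet_Ico fun t ht => ?_
        gcongr
        exacts [h t ht, ht.2.le]

theorem scaleNorm_le_mul_eLpNorm_count (hq : q ≠ 0)
    (hB : ∀ t t', 0 < t → t ≤ t' → t' ≤ 2 * t → B t ≤ c * B t') :
    scaleNorm q B ≤ c * eLpNorm (fun m : ℤ => B (2 ^ m)) q Measure.count := by
  have hsucc (m : ℤ) : (2 : ℝ) ^ (m + 1) = 2 * 2 ^ m := by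
    rw [zpow_add_one₀ two_ne_zero, mul_comm]
  have hdyadic : ∀ m : ℤ, ∀ t ∈ Ico ((2 : ℝ) ^ m) (2 ^ (m + 1)), B t ≤ c * B (2 ^ (m + 1)) :=
    fun m t ht => hB t _ ((zpow_pos two_pos m).trans_le ht.1) ht.2.le
      ((hsucc m).trans_le (by linarith [ht.1]))
  calc scaleNorm q B ≤ eLpNorm (fun m : ℤ => c * B (2 ^ (m + 1))) q Measure.count := by
        rw [eLpNorm_count_eq_ite hq, scaleNorm]
        split_ifs with hq'
        · refine iSup₂_le fun t ht => ?_
          obtain ⟨m, hm⟩ := exists_mem_Ico_zpow (mem_Ioi.1 ht) one_lt_two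
          exact le_iSup_of_le m (hdyadic m t hm)
        · rw [lintegral_Ioi_eq_tsum_Ico_zpow]
          gcongr with m
          have hbound : ∀ t ∈ Ico ((2 : ℝ) ^ m) (2 ^ (m + 1)),
              B t ^ q.toReal ≤ (c * B (2 ^ (m + 1))) ^ q.toReal := fun t ht =>
            ENNReal.rpow_le_rpow (hdyadic m t ht) ENNReal.toReal_nonneg
          rw [hsucc] at hbound ⊢
          exact setLIntegral_Ico_div_le (zpow_pos two_pos m) hbound
    _ ≤ c * eLpNorm (fun m : ℤ => B (2 ^ (m + 1))) q Measure.count :=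
        eLpNorm_count_le_mul (fun _ => le_rfl) q
    _ = c * eLpNorm (fun m : ℤ => B (2 ^ m)) q Measure.count := by
        rw [eLpNorm_count_comp (fun m : ℤ => B (2 ^ m)) (measurePreserving_add_right _ 1)]

theorem eLpNorm_count_le_mul_scaleNorm (hq : q ≠ 0) (hc : c ≠ ∞)
    (hB : ∀ t t', 0 < t → t ≤ t' → t' ≤ 2 * t → B t ≤ c * B t') :
    eLpNorm (fun m : ℤ => B (2 ^ m)) q Measure.count ≤ 2 ^ (1 / q.toReal) * c * scaleNorm q B := by
  rw [eLpNorm_count_eq_ite hq, scaleNorm]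
  split_ifs with hq'
  · subst hq'
    have htwo : (2 : ℝ≥0∞) ^ (1 / (∞ : ℝ≥0∞).toReal) = 1 := by simp
    rw [htwo, one_mul]
    refine iSup_le fun m => (hB _ _ (zpow_pos two_pos m) le_rfl ?_).trans ?_
    · linarith [zpow_pos (two_pos (α := ℝ)) m]
    · gcongr
      exact le_iSup₂_of_le (2 ^ m) (mem_Ioi.2 (zpow_pos two_pos m)) le_rfl
  · have hr : 0 < q.toReal := ENNReal.toReal_pos hq hq'
    have hcr : c ^ q.toReal ≠ ∞ := by finiteness
    have hm : ∀ m : ℤ, B (2 ^ m) ^ q.toReal ≤ 2 * (c ^ q.toReal *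
        ∫⁻ t in Ico ((2 : ℝ) ^ m) (2 ^ (m + 1)), B t ^ q.toReal / ENNReal.ofReal t) := fun m => by
      rw [← lintegral_const_mul' _ _ hcr, zpow_add_one₀ two_ne_zero, mul_comm _ (2 : ℝ)]
      simp only [← mul_div_assoc]
      refine le_two_mul_setLIntegral_Ico_div (by positivity) fun t ht => ?_
      rw [← ENNReal.mul_rpow_of_nonneg _ _ hr.le]
      gcongr
      exact hB _ t (by positivity) ht.1 ht.2.le
    calc (∑' m : ℤ, B (2 ^ m) ^ q.toReal) ^ (1 / q.toReal)
        ≤ (2 * (c ^ q.toReal * ∫⁻ t in Ioi (0 : ℝ), B t ^ q.toReal / ENNReal.ofReal t)) ^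
            (1 / q.toReal) := by
          rw [lintegral_Ioi_eq_tsum_Ico_zpow, ← ENNReal.tsum_mul_left, ← ENNReal.tsum_mul_left]
          gcongr with m
          exact hm m
      _ = _ := by
          rw [ENNReal.mul_rpow_of_nonneg _ _ (by positivity),
            ENNReal.mul_rpow_of_nonneg _ _ (by positivity), ← ENNReal.rpow_mul,
            mul_one_div_cancel hr.ne', ENNReal.rpow_one, mul_assoc]

end Scale

section ScaledDifference

variable {X : Type*} [MetricSpace X] [MeasurableSpace X] {μ : Measure X} {s : ℝ} {p q : ℝ≥0∞}
  {u : X → ℝ} {t : ℝ}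

/-- The quantity `t^{-s} (avgDiff at scale t)`, whose `L^q(dt / t)` norm is the Besov seminorm. -/
noncomputable def scaledDiff (μ : Measure X) (s : ℝ) (p : ℝ≥0∞) (u : X → ℝ) (t : ℝ) : ℝ≥0∞ :=
  ENNReal.ofReal (t ^ (-s)) * avgDiff μ p u t

theorem besovNorm_eq_scaleNorm (μ : Measure X) (s : ℝ) (p q : ℝ≥0∞) (u : X → ℝ) :
    besovNorm μ s p q u = scaleNorm q (scaledDiff μ s p u) := by
  rw [besovNorm, scaleNorm]
  split_ifs with hq
  · rfl
  · congr 1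
    refine setLIntegral_congr_fun measurableSet_Ioi fun t (ht : 0 < t) => ?_
    rw [scaledDiff, ENNReal.mul_rpow_of_nonneg _ _ ENNReal.toReal_nonneg,
      ENNReal.ofReal_rpow_of_pos (by positivity), ← Real.rpow_mul ht.le, neg_mul,
      Real.rpow_neg ht.le, ENNReal.ofReal_inv_of_pos (by positivity), Real.rpow_add ht,
      Real.rpow_one, ENNReal.ofReal_mul ht.le, div_eq_mul_inv, div_eq_mul_inv, ENNReal.mul_inv]
    · ring
    · exact .inl (ENNReal.ofReal_pos.2 ht).ne'
    · exact .inl ENNReal.ofReal_ne_top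

theorem IsDoubling.scaledDiff_le_scaledDiff [BorelSpace X] (hμ : IsDoubling μ) (hs : 0 ≤ s)
    (hp : p ≠ 0) (hu : AEStronglyMeasurable u μ) (ht : 0 < t) {t' : ℝ} (h : t ≤ t')
    (h' : t' ≤ 2 * t) : scaledDiff μ s p u t ≤
      ENNReal.ofReal (2 ^ s) * doublingConst μ ^ (1 / p).toReal * scaledDiff μ s p u t' := by
  have hweight : t ^ (-s) ≤ 2 ^ s * t' ^ (-s) := by
    have ht' : 0 < t' := ht.trans_le h
    calc t ^ (-s) ≤ (t' / 2) ^ (-s) :=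
          Real.rpow_le_rpow_of_nonpos (by positivity) (by linarith) (by linarith)
      _ = 2 ^ s * t' ^ (-s) := by
          rw [Real.div_rpow ht'.le two_pos.le, Real.rpow_neg two_pos.le, div_inv_eq_mul, mul_comm]
  calc scaledDiff μ s p u t
      ≤ ENNReal.ofReal (2 ^ s * t' ^ (-s)) *
          (doublingConst μ ^ (1 / p).toReal * avgDiff μ p u t') := by
        unfold scaledDiff
        gcongr
        exact hμ.avgDiff_le_avgDiff hp hu ht h h'
    _ = _ := by
        rw [scaledDiff, ENNReal.ofReal_mul (by positivity)]
        ring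

theorem IsDoubling.exists_besovNorm_comparable [BorelSpace X] (hμ : IsDoubling μ) (hs : 0 ≤ s)
    (hp : p ≠ 0) (hq : q ≠ 0) : ∃ C ≠ (∞ : ℝ≥0∞), ∀ u : X → ℝ, AEStronglyMeasurable u μ →
      besovNorm μ s p q u ≤
        C * eLpNorm (fun m : ℤ => scaledDiff μ s p u (2 ^ m)) q Measure.count ∧
      eLpNorm (fun m : ℤ => scaledDiff μ s p u (2 ^ m)) q Measure.count ≤
        C * besovNorm μ s p q u := by
  have hD := hμ.doublingConst_ne_top
  obtain ⟨c, hc, hquasi⟩ : ∃ c ≠ (∞ : ℝ≥0∞), ∀ u : X → ℝ, AEStronglyMeasurable u μ →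
      ∀ t t', 0 < t → t ≤ t' → t' ≤ 2 * t → scaledDiff μ s p u t ≤ c * scaledDiff μ s p u t' :=
    ⟨_, by finiteness, fun u hu t t' ht => hμ.scaledDiff_le_scaledDiff hs hp hu ht⟩
  refine ⟨2 ^ (1 / q.toReal) * c, by finiteness, fun u hu => ?_⟩
  rw [besovNorm_eq_scaleNorm]
  refine ⟨(scaleNorm_le_mul_eLpNorm_count hq (hquasi u hu)).trans ?_,
    eLpNorm_count_le_mul_scaleNorm hq hc (hquasi u hu)⟩
  gcongr
  exact le_mul_of_one_le_left' ((ENNReal.one_rpow _).ge.trans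
    (ENNReal.rpow_le_rpow one_le_two (by positivity)))

end ScaledDifference

section HajlaszGradient

variable {X : Type*} [MeasurableSpace X] {μ : Measure X} {s : ℝ} {p q : ℝ≥0∞} {u : X → ℝ}
  {g : ℤ → X → ℝ}

/-- The weighted supremum `sup_{i ≥ 0} 2^{-is} |g_{j+i}|`. For a fractional `s`-Hajłasz gradient
`g` of `u`, it controls the differences of `u` over all distances below `2^{-j}` and not just over
those comparable to `2^{-j}`. -/
noncomputable def gradientSup (s : ℝ) (g : ℤ → X → ℝ) (j : ℤ) (x : X) : ℝ≥0∞ :=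
  ⨆ i : ℕ, ENNReal.ofReal (2 ^ (-s)) ^ i * ‖g (j + i) x‖ₑ

theorem aemeasurable_gradientSup (hg : ∀ k, AEStronglyMeasurable (g k) μ) (s : ℝ) (j : ℤ) :
    AEMeasurable (gradientSup s g j) μ :=
  AEMeasurable.iSup fun i => (hg (j + i)).enorm.const_mul _

theorem two_zpow_neg_add_rpow (s : ℝ) (j : ℤ) (i : ℕ) :
    ((2 : ℝ) ^ (-(j + i))) ^ s = (2 ^ (-j)) ^ s * (2 ^ (-s)) ^ i := by
  rw [← Real.rpow_intCast, ← Real.rpow_intCast, ← Real.rpow_natCast, ← Real.rpow_mul two_pos.le,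
    ← Real.rpow_mul two_pos.le, ← Real.rpow_mul two_pos.le, ← Real.rpow_add two_pos]
  push_cast
  ring_nf

variable [MetricSpace X]

theorem IsHajlaszGradient.ae_enorm_sub_le (hs : 0 ≤ s) (hg : IsHajlaszGradient μ s u g) (j : ℤ) :
    ∀ᵐ x ∂μ, ∀ᵐ y ∂μ, dist y x < 2 ^ (-j) → ‖u x - u y‖ₑ ≤
      ENNReal.ofReal ((2 ^ (-j)) ^ s) * (gradientSup s g j x + gradientSup s g j y) := by
  obtain ⟨-, hpos, E, hE, h⟩ := hg
  have hae : ∀ᵐ x ∂μ, x ∉ E := measure_eq_zero_iff_ae_notMem.1 hE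
  filter_upwards [hae] with x hx
  filter_upwards [hae] with y hy hyx
  rw [dist_comm] at hyx
  rcases eq_or_ne x y with rfl | hxy
  · simp
  obtain ⟨n, hn⟩ := exists_mem_Ico_zpow (dist_pos.2 hxy) (one_lt_two (α := ℝ))
  have hnj : n < -j := (zpow_lt_zpow_iff_right₀ one_lt_two).1 (hn.1.trans_lt hyx)
  obtain ⟨i, hi⟩ := Int.eq_ofNat_of_zero_le (show 0 ≤ -n - 1 - j by lia)
  have hk : n + 1 = -(j + i) := by lia
  rw [hk, eq_sub_of_add_eq hk] at hn
  have hweight : dist x y ^ s ≤ (2 ^ (-j)) ^ s * (2 ^ (-s)) ^ i :=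
    (Real.rpow_le_rpow dist_nonneg hn.2.le hs).trans_eq (two_zpow_neg_add_rpow s j i)
  have hterm (z : X) : ENNReal.ofReal (2 ^ (-s)) ^ i * ‖g (j + i) z‖ₑ ≤ gradientSup s g j z :=
    le_iSup (fun i : ℕ => ENNReal.ofReal (2 ^ (-s)) ^ i * ‖g (j + i) z‖ₑ) i
  calc ‖u x - u y‖ₑ ≤ ENNReal.ofReal ((2 ^ (-j)) ^ s * (2 ^ (-s)) ^ i *
          (g (j + i) x + g (j + i) y)) := by
        rw [Real.enorm_eq_ofReal_abs]
        refine ENNReal.ofReal_le_ofReal ((h _ x y hx hy hn.1 hn.2).trans ?_)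
        gcongr
        exact add_nonneg (hpos _ x) (hpos _ y)
    _ = ENNReal.ofReal ((2 ^ (-j)) ^ s) * (ENNReal.ofReal (2 ^ (-s)) ^ i * ‖g (j + i) x‖ₑ +
          ENNReal.ofReal (2 ^ (-s)) ^ i * ‖g (j + i) y‖ₑ) := by
        rw [ENNReal.ofReal_mul (by positivity), ENNReal.ofReal_mul (by positivity),
          ENNReal.ofReal_pow (by positivity), ENNReal.ofReal_add (hpos _ x) (hpos _ y),
          Real.enorm_of_nonneg (hpos _ x), Real.enorm_of_nonneg (hpos _ y), mul_add, mul_add,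
          mul_assoc, mul_assoc]
    _ ≤ _ := by
        gcongr
        exacts [hterm x, hterm y]

theorem IsDoubling.exists_scaledDiff_le_mul_eLpNorm_gradientSup [BorelSpace X]
    (hμ : IsDoubling μ) (hs : 0 ≤ s) (hp : p ≠ 0) : ∃ C ≠ (∞ : ℝ≥0∞), ∀ (u : X → ℝ)
      (g : ℤ → X → ℝ), IsHajlaszGradient μ s u g → ∀ j : ℤ,
        scaledDiff μ s p u (2 ^ (-j)) ≤ C * eLpNorm (gradientSup s g j) p μ := by
  obtain ⟨C, hC, h⟩ := hμ.exists_avgDiff_le_mul_eLpNorm hp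
  refine ⟨C, hC, fun u g hg j => ?_⟩
  set w := ENNReal.ofReal ((2 ^ (-j)) ^ s)
  have hG := aemeasurable_gradientSup hg.1 s j
  have hw : ENNReal.ofReal (((2 : ℝ) ^ (-j)) ^ (-s)) * w = 1 := by
    rw [← ENNReal.ofReal_mul (by positivity), ← Real.rpow_add (by positivity), neg_add_cancel,
      Real.rpow_zero, ENNReal.ofReal_one]
  calc scaledDiff μ s p u (2 ^ (-j))
      ≤ ENNReal.ofReal (((2 : ℝ) ^ (-j)) ^ (-s)) *
          (C * eLpNorm (fun x => w * gradientSup s g j x) p μ) := by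
        unfold scaledDiff
        gcongr
        refine h u _ _ (by positivity) (hG.const_mul w) ?_
        simpa only [mul_add] using hg.ae_enorm_sub_le hs j
    _ ≤ ENNReal.ofReal (((2 : ℝ) ^ (-j)) ^ (-s)) * (C * (w * eLpNorm (gradientSup s g j) p μ)) := by
        gcongr
        exact eLpNorm_le_mul_eLpNorm_of_ae_le_mul'' p hG.aestronglyMeasurable
          (ae_of_all _ fun x => le_rfl)
    _ = C * eLpNorm (gradientSup s g j) p μ := by
        rw [mul_left_comm, ← mul_assoc _ w, hw, one_mul]

theorem IsDoubling.exists_besovNorm_le_mul_lqLpNorm [BorelSpace X] (hμ : IsDoubling μ)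
    (hs : 0 < s) (hp : p ≠ 0) (hq : q ≠ 0) : ∃ C ≠ (∞ : ℝ≥0∞), ∀ u : X → ℝ,
      AEStronglyMeasurable u μ → ∀ g, IsHajlaszGradient μ s u g →
        besovNorm μ s p q u ≤ C * lqLpNorm μ p q g := by
  have hρ : ENNReal.ofReal (2 ^ (-s)) < 1 :=
    ENNReal.ofReal_lt_one.2 (Real.rpow_lt_one_of_one_lt_of_neg one_lt_two (neg_lt_zero.2 hs))
  obtain ⟨C₁, hC₁, hbesov⟩ := hμ.exists_besovNorm_comparable hs.le hp hq
  obtain ⟨C₂, hC₂, hdiff⟩ := hμ.exists_scaledDiff_le_mul_eLpNorm_gradientSup hs.le hp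
  obtain ⟨C₃, hC₃, hhardy⟩ := exists_eLpNorm_count_eLpNorm_iSup_le (E := ℝ) μ hp hq hρ
  refine ⟨C₁ * C₂ * C₃, by finiteness, fun u hu g hg => ?_⟩
  calc besovNorm μ s p q u
      ≤ C₁ * eLpNorm (fun m : ℤ => scaledDiff μ s p u (2 ^ m)) q Measure.count :=
        (hbesov u hu).1
    _ = C₁ * eLpNorm (fun j : ℤ => scaledDiff μ s p u (2 ^ (-j))) q Measure.count := by
        rw [eLpNorm_count_comp (fun m : ℤ => scaledDiff μ s p u (2 ^ m))
          (Measure.measurePreserving_neg _)]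
    _ ≤ C₁ * (C₂ * eLpNorm (fun j => eLpNorm (gradientSup s g j) p μ) q Measure.count) := by
        gcongr
        exact eLpNorm_count_le_mul (hdiff u g hg) q
    _ ≤ C₁ * (C₂ * (C₃ * eLpNorm (fun k => eLpNorm (g k) p μ) q Measure.count)) := by
        gcongr
        exact hhardy g hg.1
    _ = C₁ * C₂ * C₃ * lqLpNorm μ p q g := by
        rw [lqLpNorm_eq_eLpNorm_count μ p hq]
        ring

theorem IsDoubling.exists_besovNorm_le_mul_hajlaszBesovNorm [BorelSpace X] (hμ : IsDoubling μ)
    (hs : 0 < s) (hp : p ≠ 0) (hq : q ≠ 0) :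
    ∃ C : ℝ≥0, ∀ u : X → ℝ, AEStronglyMeasurable u μ →
      besovNorm μ s p q u ≤ C * hajlaszBesovNorm μ s p q u := by
  obtain ⟨C, hC, h⟩ := hμ.exists_besovNorm_le_mul_lqLpNorm hs hp hq
  refine ⟨C.toNNReal + 1, fun u hu => ?_⟩
  rw [← ENNReal.div_le_iff' (by simp) (by finiteness)]
  refine le_iInf₂ fun g hg => ENNReal.div_le_of_le_mul' ((h u hu g hg).trans ?_)
  rw [ENNReal.coe_add, ENNReal.coe_toNNReal hC]
  gcongr
  exact le_self_add

end HajlaszGradient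

section OscillationGradient

variable {X : Type*} [MetricSpace X] [MeasurableSpace X] {μ : Measure X} {s : ℝ} {p q : ℝ≥0∞}
  {u : X → ℝ} {h : ℤ → X → ℝ≥0∞}

theorem isHajlaszGradient_toReal (hm : ∀ k, AEMeasurable (h k) μ)
    (hfin : ∀ k, ∀ᵐ x ∂μ, h k x < ∞)
    (hbound : ∀ (k : ℤ) (x y : X), 2 ^ (-k - 1) ≤ dist x y → dist x y < 2 ^ (-k) →
      ‖u x - u y‖ₑ ≤ ENNReal.ofReal (dist x y ^ s) * (h k x + h k y)) :
    IsHajlaszGradient μ s u fun k x => (h k x).toReal := by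
  refine ⟨fun k => (hm k).ennreal_toReal.aestronglyMeasurable, fun _ _ => ENNReal.toReal_nonneg,
    {x | ¬ ∀ k, h k x < ∞}, ae_iff.1 (ae_all_iff.2 hfin), fun k x y hx hy hxy hxy' => ?_⟩
  have hx : h k x ≠ ∞ := (not_not.1 hx k).ne
  have hy : h k y ≠ ∞ := (not_not.1 hy k).ne
  have hle := ENNReal.toReal_mono (by finiteness) (hbound k x y hxy hxy')
  rwa [toReal_enorm, Real.norm_eq_abs, ENNReal.toReal_mul, ENNReal.toReal_add hx hy,
    ENNReal.toReal_ofReal (by positivity)] at hle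

theorem hajlaszBesovNorm_le_eLpNorm_count (hp : p ≠ 0) (hq : q ≠ 0)
    (hm : ∀ k, AEMeasurable (h k) μ) (hfin : ∀ k, eLpNorm (h k) p μ ≠ ∞)
    (hbound : ∀ (k : ℤ) (x y : X), 2 ^ (-k - 1) ≤ dist x y → dist x y < 2 ^ (-k) →
      ‖u x - u y‖ₑ ≤ ENNReal.ofReal (dist x y ^ s) * (h k x + h k y)) :
    hajlaszBesovNorm μ s p q u ≤
      eLpNorm (fun k => eLpNorm (h k) p μ) q Measure.count := by
  have hae (k : ℤ) : ∀ᵐ x ∂μ, h k x < ∞ := ae_lt_top_of_eLpNorm_ne_top (hm k) hp (hfin k)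
  refine (iInf₂_le _ (isHajlaszGradient_toReal hm hae hbound)).trans_eq ?_
  rw [lqLpNorm_eq_eLpNorm_count μ p hq]
  refine congrArg (eLpNorm · q Measure.count) (funext fun k => eLpNorm_congr_enorm_ae ?_)
  exact (hae k).mono fun x hx => Real.enorm_toReal hx.ne

namespace IsDoubling

theorem exists_enorm_sub_le_rpow_mul_localOsc_add (hμ : IsDoubling μ) (hs : 0 ≤ s) (hp : p ≠ 0) :
    ∃ C ≠ (∞ : ℝ≥0∞), ∀ u : X → ℝ, AEStronglyMeasurable u μ → ∀ t > 0, ∀ x y,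
      t ≤ 4 * dist x y → 2 * dist x y < t → ‖u x - u y‖ₑ ≤ ENNReal.ofReal (dist x y ^ s) *
        (C * ENNReal.ofReal (t ^ (-s)) * localOsc μ p u t x +
          C * ENNReal.ofReal (t ^ (-s)) * localOsc μ p u t y) := by
  obtain ⟨C, hC, h⟩ := hμ.exists_enorm_sub_le_localOsc_add hp
  refine ⟨ENNReal.ofReal (4 ^ s) * C, by finiteness, fun u hu t ht x y hle hlt => ?_⟩
  have hweight : 1 ≤ ENNReal.ofReal (dist x y ^ s * (4 ^ s * t ^ (-s))) := by
    rw [ENNReal.one_le_ofReal, ← mul_assoc, ← Real.mul_rpow dist_nonneg (by norm_num),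
      Real.rpow_neg ht.le, ← div_eq_mul_inv, one_le_div (by positivity), mul_comm]
    exact Real.rpow_le_rpow ht.le hle hs
  have hosc := h u hu (t / 2) (by positivity) x y (by linarith)
  rw [mul_div_cancel₀ t two_ne_zero] at hosc
  calc ‖u x - u y‖ₑ
      ≤ ENNReal.ofReal (dist x y ^ s * (4 ^ s * t ^ (-s))) *
          (C * (localOsc μ p u t x + localOsc μ p u t y)) :=
        hosc.trans (le_mul_of_one_le_left' hweight)
    _ = _ := by
        rw [ENNReal.ofReal_mul (by positivity), ENNReal.ofReal_mul (by positivity)]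
        ring

variable [BorelSpace X]

theorem eLpNorm_ofReal_mul_localOsc_le (hμ : IsDoubling μ) (hp : p ≠ 0)
    (hu : AEStronglyMeasurable u μ) (s : ℝ) (c : ℝ≥0∞) {t : ℝ} (ht : 0 < t) :
    eLpNorm (fun x => c * ENNReal.ofReal (t ^ (-s)) * localOsc μ p u t x) p μ ≤
      c * scaledDiff μ s p u t := by
  rw [scaledDiff, hμ.avgDiff_eq_eLpNorm_localOsc hp u ht, ← mul_assoc]
  exact eLpNorm_le_mul_eLpNorm_of_ae_le_mul'' p
    (hμ.aemeasurable_localOsc hu p t).aestronglyMeasurable (ae_of_all _ fun x => le_rfl)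

theorem scaledDiff_two_zpow_ne_top (hμ : IsDoubling μ) (hs : 0 ≤ s) (hp : p ≠ 0) (hq : q ≠ 0)
    (hu : AEStronglyMeasurable u μ) (hfin : besovNorm μ s p q u ≠ ∞) (m : ℤ) :
    scaledDiff μ s p u (2 ^ m) ≠ ∞ := by
  obtain ⟨C, hC, h⟩ := hμ.exists_besovNorm_comparable (s := s) hs hp hq
  refine ne_top_of_le_ne_top ?_
    (enorm_le_eLpNorm_count (fun m : ℤ => scaledDiff μ s p u (2 ^ m)) m hq)
  exact ne_top_of_le_ne_top (by finiteness) (h u hu).2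

theorem exists_hajlaszBesovNorm_le_mul_besovNorm (hμ : IsDoubling μ) (hs : 0 ≤ s) (hp : p ≠ 0)
    (hq : q ≠ 0) : ∃ C : ℝ≥0, ∀ u : X → ℝ, AEStronglyMeasurable u μ →
      besovNorm μ s p q u ≠ ∞ → hajlaszBesovNorm μ s p q u ≤ C * besovNorm μ s p q u := by
  obtain ⟨C₁, hC₁, hosc⟩ := hμ.exists_enorm_sub_le_rpow_mul_localOsc_add hs hp
  obtain ⟨C₂, hC₂, hbesov⟩ := hμ.exists_besovNorm_comparable hs hp hq
  refine ⟨(C₁ * C₂).toNNReal, fun u hu hfin => ?_⟩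
  rw [ENNReal.coe_toNNReal (by finiteness)]
  set h : ℤ → X → ℝ≥0∞ := fun k x =>
    C₁ * ENNReal.ofReal ((2 ^ (1 - k)) ^ (-s)) * localOsc μ p u (2 ^ (1 - k)) x
  have hm (k : ℤ) : AEMeasurable (h k) μ := (hμ.aemeasurable_localOsc hu p _).const_mul _
  have hnorm (k : ℤ) : eLpNorm (h k) p μ ≤ C₁ * scaledDiff μ s p u (2 ^ (1 - k)) :=
    hμ.eLpNorm_ofReal_mul_localOsc_le hp hu s C₁ (zpow_pos two_pos _)
  have htop (k : ℤ) : eLpNorm (h k) p μ ≠ ∞ := by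
    have := hμ.scaledDiff_two_zpow_ne_top hs hp hq hu hfin (1 - k)
    exact ne_top_of_le_ne_top (by finiteness) (hnorm k)
  have hbound (k : ℤ) (x y : X) (hle : 2 ^ (-k - 1) ≤ dist x y) (hlt : dist x y < 2 ^ (-k)) :
      ‖u x - u y‖ₑ ≤ ENNReal.ofReal (dist x y ^ s) * (h k x + h k y) := by
    have hk : (2 : ℝ) ^ (1 - k) = 2 * 2 ^ (-k) := by
      rw [sub_eq_add_neg, zpow_one_add₀ two_ne_zero]
    rw [zpow_sub_one₀ two_ne_zero] at hle
    exact hosc u hu _ (zpow_pos two_pos _) x y (by linarith) (by linarith)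
  calc hajlaszBesovNorm μ s p q u ≤ eLpNorm (fun k => eLpNorm (h k) p μ) q Measure.count :=
        hajlaszBesovNorm_le_eLpNorm_count hp hq hm htop hbound
    _ ≤ C₁ * eLpNorm (fun k : ℤ => scaledDiff μ s p u (2 ^ (1 - k))) q Measure.count :=
        eLpNorm_count_le_mul hnorm q
    _ = C₁ * eLpNorm (fun m : ℤ => scaledDiff μ s p u (2 ^ m)) q Measure.count := by
        rw [eLpNorm_count_comp (fun m : ℤ => scaledDiff μ s p u (2 ^ m))
          (Measure.measurePreserving_sub_left _ 1)]
    _ ≤ C₁ * C₂ * besovNorm μ s p q u := by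
        rw [mul_assoc]
        gcongr
        exact (hbesov u hu).2

end IsDoubling

end OscillationGradient

section Space

theorem aestronglyMeasurable_of_forall_ball {X : Type*} [PseudoMetricSpace X] [MeasurableSpace X]
    {μ : Measure X} {u : X → ℝ}
    (hu : ∀ (x : X) (r : ℝ), 0 < r → AEStronglyMeasurable u (μ.restrict (ball x r))) :
    AEStronglyMeasurable u μ := by
  rcases isEmpty_or_nonempty X with hX | ⟨⟨x₀⟩⟩
  · rw [Measure.eq_zero_of_isEmpty μ]
    exact aestronglyMeasurable_zero_measure u
  · rw [← Measure.restrict_univ (μ := μ), ← iUnion_ball_nat_succ x₀,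
      aestronglyMeasurable_iUnion_iff]
    exact fun n => hu x₀ _ (by positivity)

variable {X : Type*} [MetricSpace X] [MeasurableSpace X] {μ : Measure X} {s : ℝ} {p q : ℝ≥0∞}
  {u : X → ℝ}

namespace IsDoubling

theorem memLp_ball_of_localOsc_ne_top (hμ : IsDoubling μ) (hu : AEStronglyMeasurable u μ) {x : X}
    {t : ℝ} (ht : 0 < t) (h : localOsc μ p u t x ≠ ∞) : MemLp u p (μ.restrict (ball x t)) := by
  have htop := (hμ.ball_lt_top x t ht).ne
  have : IsFiniteMeasure (μ.restrict (ball x t)) := isFiniteMeasure_restrict.2 htop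
  have hrestrict : μ.restrict (ball x t) ≤ μ (ball x t) • μ[|ball x t] := by
    rw [ProbabilityTheory.cond, smul_smul,
      ENNReal.mul_inv_cancel (hμ.ball_pos x t ht).ne' htop, one_smul]
  have hdiff : MemLp (fun y => u x - u y) p μ[|ball x t] :=
    ⟨aestronglyMeasurable_const.sub (hu.mono_ac cond_absolutelyContinuous), h.lt_top⟩
  simpa only [Pi.sub_def, sub_sub_cancel] using
    (memLp_const (u x)).sub (hdiff.of_measure_le_smul htop hrestrict)

theorem memLp_ball_of_besovNorm_ne_top [BorelSpace X] (hμ : IsDoubling μ) (hs : 0 ≤ s)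
    (hp : p ≠ 0) (hq : q ≠ 0) (hu : AEStronglyMeasurable u μ) (hfin : besovNorm μ s p q u ≠ ∞)
    (x₀ : X) {r : ℝ} (hr : 0 < r) : MemLp u p (μ.restrict (ball x₀ r)) := by
  obtain ⟨n, hn⟩ := exists_mem_Ico_zpow (show 0 < 2 * r by positivity) (one_lt_two (α := ℝ))
  have ht : (0 : ℝ) < 2 ^ (n + 1) := zpow_pos two_pos _
  have hosc : ∀ᵐ x ∂μ, localOsc μ p u (2 ^ (n + 1)) x < ∞ := by
    refine ae_lt_top_of_eLpNorm_ne_top (hμ.aemeasurable_localOsc hu p _) hp ?_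
    rw [← hμ.avgDiff_eq_eLpNorm_localOsc hp u ht]
    intro htop
    refine hμ.scaledDiff_two_zpow_ne_top hs hp hq hu hfin (n + 1) ?_
    rw [scaledDiff, htop, ENNReal.mul_top (ENNReal.ofReal_pos.2 (by positivity)).ne']
  have hball : ∃ᵐ x ∂μ, x ∈ ball x₀ r := frequently_ae_mem_iff.2 (hμ.ball_pos x₀ r hr).ne'
  obtain ⟨x, hx, hxosc⟩ := (hball.and_eventually hosc).exists
  refine (hμ.memLp_ball_of_localOsc_ne_top hu ht hxosc.ne).mono_measure
    (Measure.restrict_mono (ball_subset_ball' ?_) le_rfl)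
  linarith [mem_ball'.1 hx, hn.2]

theorem mem_besovSpace_iff [BorelSpace X] (hμ : IsDoubling μ) (hs : 0 ≤ s) (hp : p ≠ 0)
    (hq : q ≠ 0) :
    u ∈ besovSpace μ s p q ↔ AEStronglyMeasurable u μ ∧ besovNorm μ s p q u < ∞ :=
  ⟨fun ⟨hu, hfin⟩ => ⟨aestronglyMeasurable_of_forall_ball fun x r hr => (hu x r hr).1, hfin⟩,
    fun ⟨hu, hfin⟩ =>
      ⟨fun x _ hr => hμ.memLp_ball_of_besovNorm_ne_top hs hp hq hu hfin.ne x hr, hfin⟩⟩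

theorem hajlaszBesovSpace_eq_besovSpace [BorelSpace X] (hμ : IsDoubling μ) (hs : 0 < s)
    (hp : p ≠ 0) (hq : q ≠ 0) : hajlaszBesovSpace μ s p q = besovSpace μ s p q := by
  obtain ⟨C, hC⟩ := hμ.exists_besovNorm_le_mul_hajlaszBesovNorm hs hp hq
  obtain ⟨C', hC'⟩ := hμ.exists_hajlaszBesovNorm_le_mul_besovNorm hs.le hp hq
  ext u
  rw [hμ.mem_besovSpace_iff hs.le hp hq]
  refine and_congr_right fun hu => ⟨fun h => (hC u hu).trans_lt ?_, fun h =>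
    (hC' u hu h.ne).trans_lt ?_⟩
  · exact ENNReal.mul_lt_top ENNReal.coe_lt_top h
  · exact ENNReal.mul_lt_top ENNReal.coe_lt_top h

end IsDoubling

end Space

end MetricBesov

theorem theorem1p2 {X : Type*} [MetricSpace X] [MeasurableSpace X] [BorelSpace X]
    (μ : Measure X) (hμ : MetricBesov.IsDoubling μ)
    (s : ℝ) (hs : 0 < s) (p q : ℝ≥0∞) (hp : 0 < p) (hq : 0 < q) :
    MetricBesov.hajlaszBesovSpace μ s p q = MetricBesov.besovSpace μ s p q ∧
      ∃ C : ℝ≥0, ∀ u ∈ MetricBesov.hajlaszBesovSpace μ s p q,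
        MetricBesov.besovNorm μ s p q u ≤ C * MetricBesov.hajlaszBesovNorm μ s p q u ∧
          MetricBesov.hajlaszBesovNorm μ s p q u ≤ C * MetricBesov.besovNorm μ s p q u := by
  have hspace := hμ.hajlaszBesovSpace_eq_besovSpace hs hp.ne' hq.ne'
  obtain ⟨C, hC⟩ := hμ.exists_besovNorm_le_mul_hajlaszBesovNorm hs hp.ne' hq.ne'
  obtain ⟨C', hC'⟩ := hμ.exists_hajlaszBesovNorm_le_mul_besovNorm hs.le hp.ne' hq.ne'
  refine ⟨hspace, max C C', fun u hu => ?_⟩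
  have hfin : MetricBesov.besovNorm μ s p q u ≠ ∞ := (hspace ▸ hu).2.ne
  constructor
  · exact (hC u hu.1).trans (by gcongr; exact le_max_left C C')
  · exact (hC' u hu.1 hfin).trans (by gcongr; exact le_max_right C C')
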